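/- **Definitions.** Let $L$ be the face lattice of a polytope, ordered by inclusion, with least element $\hat 0$ (the empty face) and greatest element $\hat 1$ (the polytope). For $p\in L$ let $\operatorname{rank}(p)$ be the length of a maximal chain from $\hat 0$ to $p$, and let $\operatorname{rank}(L)=\operatorname{rank}(\hat 1)$. The polynomials $h(L,x)$ and $g(L,x)$ are defined inductively, applying the same definition to the intervals $[\hat 0,p]$: $h=g=1$ if $L$ has one element, and, if $\operatorname{rank}(L)=d+1>0$, $$h(L,x)=\sum_{p\in L\setminus\{\hat 1\}} g([\hat 0,p],x)\,(x-1)^{\operatorname{rank}(L)-\operatorname{rank}(p)-1}=h_0+h_1x+\cdots+h_dx^d,$$ $$g(L,x)=h_0+\sum_{i=1}^{\lfloor d/2\rfloor}(h_i-h_{i-1})x^i .$$ The toric $h$-vector of a $d$-dimensional polytope $P$ with face lattice $L$ is the sequence $(h_0(P),\dots,h_d(P))$ of coefficients of $h(L,x)$. The hypersimplex $\Delta_{k,n}$ is the convex hull of all $0/1$-vectors in $\mathbb R^n$ with exactly $k$ ones, and $\Delta_{k,n}^*$ is its dual polytope, that is, its polar in its $(n-1)$-dimensional affine hull, taken with respect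 to any point of its relative interior as the origin. **Theorem (Toric $h$-numbers).** Let $1\le k\le\lfloor n/2\rfloor$. Then $$h_r(\Delta_{k,n}^*)=\begin{cases}\displaystyle\sum_{i=0}^{r}\binom ni & \text{if } 0\le r\le k-1,\\[2ex] \displaystyle\sum_{i=0}^{k-1}\binom ni & \text{if } k\le r\le\lfloor n/2\rfloor,\end{cases}$$ and the remaining entries are given by the symmetry $h_r(\Delta_{k,n}^*)=h_{n-1-r}(\Delta_{k,n}^*)$ for $0\le r\le n-1$. -/

import Mathlib

open Polynomial

noncomputable section

/-- The rank of an element `p` of a finite poset: the length of a longest chain with top `p`.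
In a graded poset with least element this is the rank of the interval below `p`. -/
def posetRank {L : Type*} [PartialOrder L] (p : L) : ℕ := (Order.height p).toNat

/-- The `g`-polynomial of a poset of rank `m`, computed from its `h`-polynomial
`h₀ + h₁ x + ⋯ + h_d x ^ d`, where `d = m - 1`: it is `1` if `m = 0`, and
`h₀ + (h₁ - h₀) x + ⋯ + (h_e - h_{e-1}) x ^ e` with `e = ⌊d / 2⌋` otherwise. -/
def gOfH (m : ℕ) (h : ℤ[X]) : ℤ[X] :=
  if m = 0 then 1
  else C (h.coeff 0) +
    ∑ i ∈ Finset.Icc 1 ((m - 1) / 2), C (h.coeff i - h.coeff (i - 1)) * X ^ i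

open Classical in
/-- The toric `h`-polynomial of the interval `[0̂, p]` of a finite poset with least element,
by recursion on `p`: it is `1` for `p = 0̂`, and otherwise
`∑ q < p, g([0̂, q], x) * (x - 1) ^ (rank p - rank q - 1)`. -/
def toricHBelow {L : Type*} [PartialOrder L] [OrderBot L] [Finite L] (p : L) : ℤ[X] :=
  if p = ⊥ then 1
  else
    letI := Fintype.ofFinite L
    ∑ q : {q : L // q < p},
      gOfH (posetRank q.1) (toricHBelow q.1) * (X - 1) ^ (posetRank p - posetRank q.1 - 1)
termination_by wellFounded_lt.wrap p
decreasing_by exact q.2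

/-- The toric `h`-polynomial `h(L, x)` of a finite bounded poset `L`. -/
def toricHPoly (L : Type*) [PartialOrder L] [BoundedOrder L] [Finite L] : ℤ[X] :=
  toricHBelow (⊤ : L)

/-- The faces of a polytope `P`, ordered by inclusion: the empty face, and the sets of
maximizers on `P` of linear functionals (among them `P` itself). -/
abbrev FaceLattice {E : Type*} [AddCommGroup E] [TopologicalSpace E] [Module ℝ E]
    (P : Set E) : Type _ :=
  {F : Set E // IsExposed ℝ P F}

instance {E : Type*} [AddCommGroup E] [TopologicalSpace E] [Module ℝ E] (P : Set E) :
    BoundedOrder (FaceLattice P) where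
  top := ⟨P, IsExposed.refl P⟩
  le_top F := F.2.subset
  bot := ⟨∅, isExposed_empty⟩
  bot_le F := Set.empty_subset F.1

open Classical in
/-- The `r`-th entry of the toric `h`-vector of a polytope `P`. A polytope has finitely many
faces; for a set with infinitely many exposed faces the value is `0` by convention. -/
def toricH {E : Type*} [AddCommGroup E] [TopologicalSpace E] [Module ℝ E]
    (P : Set E) (r : ℕ) : ℤ :=
  if _ : Finite (FaceLattice P) then (toricHPoly (FaceLattice P)).coeff r else 0

/-- The hypersimplex: the convex hull of all `0/1`-vectors in `ℝⁿ` with exactly `k` ones. -/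
def hypersimplex (k n : ℕ) : Set (EuclideanSpace ℝ (Fin n)) :=
  convexHull ℝ {v | (∀ i, v i = 0 ∨ v i = 1) ∧ {i | v i = 1}.ncard = k}

/-- The dual (polar) polytope of `P`, formed inside the affine hull of `P` with the point `c`
of its relative interior as the origin. -/
def dualPolytope {E : Type*} [NormedAddCommGroup E] [InnerProductSpace ℝ E]
    (P : Set E) (c : E) : Set E :=
  {y | y ∈ (affineSpan ℝ P).direction ∧ ∀ x ∈ P, inner ℝ y (x - c) ≤ 1}

end

/-! A face of positive dimension of the hypersimplex (possibly the whole of it) arises by fixing the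
coordinates in `A` to 1 and those in `B` to 0, with `|A| < k` and `|B| < n - k`. Dually, these
pairs, the pairs `(S, Sᶜ)` and a top element form the face lattice of the dual, ordered by
inclusion.

Below a proper pair the lattice is Boolean, so `g = 1` (`gModel_isProper`). Below `(S, Sᶜ)` lie the
pairs of proper subsets, i.e. the join of two simplex boundaries, so `(x-1)² h = (x^k - 1)(x^(n-k) -
1)`; since `k ≤ n - k`, this gives `g = 1 + ⋯ + x^(k-1)` (`gModel_isFacet`). At the top, `(x-1) h`
is the sum of `(x-1)^(n-|A|-|B|)` over proper pairs plus `C(n,k) (x^k - 1)`. The binomial theorem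
(`sum_isProper`) turns it into `∑_{i<k} C(n,i) (x^(n-i) - x^i)`, hence `h = ∑_{i<k} C(n,i) (x^i + ⋯
+ x^(n-i-1))`.

Geometrically, a nonempty face of the dual is determined by its tight inequalities. When there are
any, they form the set of maximizers of a weight on the `k`-subsets. `exists_supports_of_max` and
`exists_tight` match these sets with the pairs. -/

namespace HypersimplexDual

/-! ### The combinatorial model and its rank function -/

/-- The pairs `(A, B)` such that fixing the coordinates in `A` to `1` and those in `B` to `0`
cuts out a face of positive dimension of the hypersimplex. -/
def IsProper {n : ℕ} (k : ℕ) (p : Finset (Fin n) × Finset (Fin n)) : Prop :=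
  Disjoint p.1 p.2 ∧ p.1.card < k ∧ p.2.card + k < n

/-- The pairs `(S, Sᶜ)` that correspond to the vertices of the hypersimplex. -/
def IsFacet {n : ℕ} (k : ℕ) (p : Finset (Fin n) × Finset (Fin n)) : Prop :=
  p.1.card = k ∧ p.2 = p.1ᶜ

/-- The combinatorial model of the face lattice of the dual hypersimplex. -/
abbrev CoFace (k n : ℕ) : Type :=
  {p : Finset (Fin n) × Finset (Fin n) //
    IsProper k p ∨ IsFacet k p ∨ p = (Finset.univ, Finset.univ)}

/-- The rank function of `CoFace k n`. -/
def coRank {n : ℕ} (k : ℕ) (p : Finset (Fin n) × Finset (Fin n)) : ℕ :=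
  if Disjoint p.1 p.2 then (if p.1.card < k then p.1.card + p.2.card else n - 1) else n

lemma coRank_of_isProper {n k : ℕ} {p : Finset (Fin n) × Finset (Fin n)} (h : IsProper k p) :
    coRank k p = p.1.card + p.2.card := by
  simp [coRank, h.1, h.2.1]

lemma coRank_of_isFacet {n k : ℕ} {p : Finset (Fin n) × Finset (Fin n)} (h : IsFacet k p) :
    coRank k p = n - 1 := by
  have : Disjoint p.1 p.2 := by rw [h.2]; exact disjoint_compl_right
  simp [coRank, this, h.1]

lemma coRank_top {n k : ℕ} (hn : 0 < n) :
    coRank k ((Finset.univ, Finset.univ) : Finset (Fin n) × Finset (Fin n)) = n := by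
  have : (Finset.univ : Finset (Fin n)) ≠ ∅ := by
    have : Nonempty (Fin n) := ⟨⟨0, hn⟩⟩
    exact Finset.univ_nonempty.ne_empty
  simp [coRank, this]

lemma card_add_card_lt {n : ℕ} {p q : Finset (Fin n) × Finset (Fin n)} (h : p < q) :
    p.1.card + p.2.card < q.1.card + q.2.card := by
  rcases Prod.lt_iff.1 h with ⟨h1, h2⟩ | ⟨h1, h2⟩
  · exact add_lt_add_of_lt_of_le (Finset.card_lt_card h1) (Finset.card_le_card h2)
  · exact add_lt_add_of_le_of_lt (Finset.card_le_card h1) (Finset.card_lt_card h2)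

lemma coRank_strictMono {k n : ℕ} (hk : 0 < k) (hkn : k < n) :
    StrictMono (fun p : CoFace k n => coRank k p.1) := by
  rintro ⟨p, hp⟩ ⟨q, hq⟩ hpq
  replace hpq : p < q := hpq
  have hc := card_add_card_lt hpq
  have h1 : p.1.card ≤ q.1.card := Finset.card_le_card hpq.le.1
  have h2 : p.2.card ≤ q.2.card := Finset.card_le_card hpq.le.2
  have hn : 0 < n := by omega
  simp only
  rcases hq with hq | hq | rfl
  · rcases hp with hp | hp | rfl
    · rwa [coRank_of_isProper hp, coRank_of_isProper hq]
    · exact absurd hp.1 (by have := hq.2.1; omega)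
    · simp at h1; exact absurd h1 (by have := hq.2.1; omega)
  · have hq1 := hq.1
    have hq2 : q.2.card = n - k := by rw [hq.2, Finset.card_compl, hq.1, Fintype.card_fin]
    rcases hp with hp | hp | rfl
    · rw [coRank_of_isProper hp, coRank_of_isFacet hq]
      have := hp.2.1; have := hp.2.2; omega
    · have hp2 : p.2.card = n - k := by rw [hp.2, Finset.card_compl, hp.1, Fintype.card_fin]
      have := hp.1; omega
    · simp at h1; omega
  · rw [coRank_top hn]
    rcases hp with hp | hp | rfl
    · rw [coRank_of_isProper hp]
      have := hp.2.1; have := hp.2.2; omega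
    · rw [coRank_of_isFacet hp]; omega
    · exact absurd hpq (lt_irrefl _)

lemma isProper_of_le {k n : ℕ} {p q : Finset (Fin n) × Finset (Fin n)} (hq : IsProper k q)
    (h : p ≤ q) : IsProper k p :=
  ⟨hq.1.mono h.1 h.2, (Finset.card_le_card h.1).trans_lt hq.2.1,
    lt_of_le_of_lt (Nat.add_le_add_right (Finset.card_le_card h.2) k) hq.2.2⟩

lemma isProper_of_ssubset_facet {k n : ℕ} (hkn : k < n)
    {p q : Finset (Fin n) × Finset (Fin n)} (hq : IsFacet k q)
    (h1 : p.1 ⊂ q.1) (h2 : p.2 ⊂ q.2) : IsProper k p := by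
  have h3 := Finset.card_lt_card h1
  have h4 := Finset.card_lt_card h2
  have hq2 : q.2.card = n - k := by rw [hq.2, Finset.card_compl, hq.1, Fintype.card_fin]
  refine ⟨?_, by rw [← hq.1]; exact h3, by omega⟩
  have : Disjoint q.1 q.2 := by rw [hq.2]; exact disjoint_compl_right
  exact this.mono h1.subset h2.subset

lemma exists_coRank_pred {k n : ℕ} (hk : 0 < k) (hkn : k < n) (q : CoFace k n)
    (h : coRank k q.1 ≠ 0) : ∃ p : CoFace k n, p < q ∧ coRank k p.1 + 1 = coRank k q.1 := by
  obtain ⟨q, hq⟩ := q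
  simp only at h
  rcases hq with hq | hq | rfl
  · rw [coRank_of_isProper hq] at h
    have key : ∀ p : Finset (Fin n) × Finset (Fin n), p < q →
        p.1.card + p.2.card + 1 = q.1.card + q.2.card →
        ∃ p : CoFace k n, p < ⟨q, Or.inl hq⟩ ∧ coRank k p.1 + 1 = coRank k q := by
      intro p hp hc
      have hpp := isProper_of_le hq hp.le
      exact ⟨⟨p, Or.inl hpp⟩, hp, by rw [coRank_of_isProper hpp, coRank_of_isProper hq, hc]⟩
    rcases q.1.eq_empty_or_nonempty with h1 | ⟨i, hi⟩
    · rcases q.2.eq_empty_or_nonempty with h2 | ⟨i, hi⟩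
      · simp [h1, h2] at h
      · refine key (q.1, q.2.erase i)
          (Prod.lt_iff.2 (Or.inr ⟨le_rfl, Finset.erase_ssubset hi⟩)) ?_
        have := Finset.card_erase_add_one hi
        simp only; omega
    · refine key (q.1.erase i, q.2)
        (Prod.lt_iff.2 (Or.inl ⟨Finset.erase_ssubset hi, le_rfl⟩)) ?_
      have := Finset.card_erase_add_one hi
      simp only; omega
  · have hq2 : q.2.card = n - k := by rw [hq.2, Finset.card_compl, hq.1, Fintype.card_fin]
    obtain ⟨i, hi⟩ : q.1.Nonempty := Finset.card_pos.1 (by rw [hq.1]; exact hk)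
    obtain ⟨j, hj⟩ : q.2.Nonempty := Finset.card_pos.1 (by rw [hq2]; omega)
    -- An element must leave both sides: if one side keeps its full size, the pair still determines
    -- the vertex. This is why a facet has rank `n - 1` although its two sets have `n` elements
    -- together.
    have hpp : IsProper k (q.1.erase i, q.2.erase j) :=
      isProper_of_ssubset_facet hkn hq (Finset.erase_ssubset hi) (Finset.erase_ssubset hj)
    refine ⟨⟨_, Or.inl hpp⟩,
      Prod.lt_iff.2 (Or.inl ⟨Finset.erase_ssubset hi, Finset.erase_subset _ _⟩), ?_⟩
    rw [coRank_of_isProper hpp, coRank_of_isFacet hq]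
    have := Finset.card_erase_add_one hi
    have := Finset.card_erase_add_one hj
    have := hq.1
    simp only; omega
  · obtain ⟨S, -, hS⟩ := Finset.exists_subset_card_eq
      (s := (Finset.univ : Finset (Fin n))) (n := k) (by simpa using hkn.le)
    have hf : IsFacet k (S, Sᶜ) := ⟨hS, rfl⟩
    refine ⟨⟨_, Or.inr (Or.inl hf)⟩, Prod.lt_iff.2 (Or.inl ⟨?_, Finset.subset_univ _⟩), ?_⟩
    · refine Finset.ssubset_univ_iff.2 ?_
      rintro rfl
      simp at hS; omega
    · rw [coRank_of_isFacet hf, coRank_top (by omega)]; omega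

/-- A strictly monotone function without gaps below its values is the rank function. -/
lemma posetRank_eq {L : Type*} [PartialOrder L] (ρ : L → ℕ) (hρ : StrictMono ρ)
    (hpred : ∀ q, ρ q ≠ 0 → ∃ p < q, ρ p + 1 = ρ q) (q : L) : posetRank q = ρ q := by
  have key : ∀ m, ∀ q, ρ q = m → Order.height q = m := by
    intro m
    induction m using Nat.strong_induction_on with
    | _ m ih =>
      rintro q rfl
      have hlt : ∀ y < q, Order.height y < (ρ q : ℕ∞) := fun y hy => by
        rw [ih _ (hρ hy) y rfl]; exact_mod_cast hρ hy
      refine Order.height_eq_coe_iff.2 ⟨?_, ?_, hlt⟩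
      · exact lt_of_le_of_lt (Order.height_le_coe_iff.2 hlt) (ENat.natCast_lt_top _)
      · by_cases h0 : ρ q = 0
        · exact Or.inl h0
        · obtain ⟨p, hp, he⟩ := hpred q h0
          refine Or.inr ⟨p, hp, ?_⟩
          rw [ih _ (hρ hp) p rfl, ← he]; norm_cast
  rw [posetRank, key _ q rfl]; rfl

/-! ### Toric polynomials of the lower intervals -/

open Classical in
lemma toricHBelow_of_ne_bot {L : Type*} [PartialOrder L] [OrderBot L] [Fintype L] {p : L}
    (hp : p ≠ ⊥) :
    toricHBelow p = ∑ q ∈ Finset.univ.filter (· < p),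
      gOfH (posetRank q) (toricHBelow q) * (X - 1) ^ (posetRank p - posetRank q - 1) := by
  rw [toricHBelow, if_neg hp]
  rw [Finset.sum_subtype (p := fun q => q < p) _ (by simp)]

section Model

variable {k n : ℕ}

lemma posetRank_model {L : Type*} [PartialOrder L] (hk : 0 < k) (hkn : k < n) (e : CoFace k n ≃o L) (p : CoFace k n) :
    posetRank (e p) = coRank k p.1 := by
  rw [posetRank, Order.height_orderIso]
  exact posetRank_eq (fun p : CoFace k n => coRank k p.1) (coRank_strictMono hk hkn)
    (exists_coRank_pred hk hkn) p

variable {L : Type*} [PartialOrder L] [OrderBot L] [Finite L]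

/-- The `g`-polynomial of the lower interval of `L` at the element modelled by `p`. -/
noncomputable def gModel (e : CoFace k n ≃o L) (p : CoFace k n) : ℤ[X] :=
  gOfH (coRank k p.1) (toricHBelow (e p))

open Classical in
-- The extra factor absorbs the `- 1` in the exponents, so that the sums become binomial expansions.
lemma X_sub_one_mul_toricHBelow (hk : 0 < k) (hkn : k < n) (e : CoFace k n ≃o L)
    (p : CoFace k n) (hp : coRank k p.1 ≠ 0) :
    (X - 1) * toricHBelow (e p) = ∑ q ∈ Finset.univ.filter (· < p),
      gModel e q * (X - 1) ^ (coRank k p.1 - coRank k q.1) := by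
  have := Fintype.ofFinite L
  have hb : e p ≠ ⊥ := by
    obtain ⟨q, hq, -⟩ := exists_coRank_pred hk hkn p hp
    exact (lt_of_le_of_lt bot_le (e.lt_iff_lt.2 hq)).ne'
  rw [toricHBelow_of_ne_bot hb, Finset.mul_sum]
  symm
  refine Finset.sum_equiv e.toEquiv (by simp) ?_
  intro q hq
  have hlt := coRank_strictMono hk hkn (Finset.mem_filter.1 hq).2
  simp only at hlt
  simp only [RelIso.coe_fn_toEquiv, posetRank_model hk hkn, gModel]
  rw [mul_left_comm, ← pow_succ']
  congr 2
  omega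

open Classical in
/-- A sum over the elements of `CoFace k n` below `p` as a sum over pairs of finsets. -/
lemma sum_lt_eq (p : CoFace k n) (s : Finset (Finset (Fin n) × Finset (Fin n)))
    (hs : ∀ q, q ∈ s ↔ (IsProper k q ∨ IsFacet k q ∨ q = (Finset.univ, Finset.univ)) ∧ q < p.1)
    (f : CoFace k n → ℤ[X]) (f' : Finset (Fin n) × Finset (Fin n) → ℤ[X])
    (hf : ∀ q, q < p → f q = f' q.1) :
    ∑ q ∈ Finset.univ.filter (· < p), f q = ∑ q ∈ s, f' q := by
  refine Finset.sum_bij (fun q _ => q.1) ?_ ?_ ?_ ?_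
  · intro q hq
    exact (hs _).2 ⟨q.2, (Finset.mem_filter.1 hq).2⟩
  · intro a _ b _ h; exact Subtype.ext h
  · intro q hq
    exact ⟨⟨q, ((hs q).1 hq).1⟩, Finset.mem_filter.2 ⟨Finset.mem_univ _, ((hs q).1 hq).2⟩, rfl⟩
  · intro q hq
    exact hf q (Finset.mem_filter.1 hq).2

lemma X_sub_one_ne_zero : (X - 1 : ℤ[X]) ≠ 0 := by
  simpa using X_sub_C_ne_zero (1 : ℤ)

lemma sum_powerset_pow (s : Finset (Fin n)) :
    ∑ t ∈ s.powerset, (X - 1 : ℤ[X]) ^ (s.card - t.card) = X ^ s.card := by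
  have := Finset.sum_pow_mul_eq_add_pow (1 : ℤ[X]) (X - 1) s
  simpa using this

/-- The interval below is Boolean. By induction all smaller `g` are 1, so `(X - 1) h = X ^ r - 1` at
rank `r`; thus `h` has constant coefficients and its differences vanish. -/
lemma gModel_isProper (hk : 0 < k) (hkn : k < n) (e : CoFace k n ≃o L) :
    ∀ (p : CoFace k n), IsProper k p.1 → gModel e p = 1 := by
  classical
  intro p
  induction p using WellFoundedLT.induction with
  | _ p ih =>
  intro hp
  by_cases h0 : coRank k p.1 = 0
  · simp [gModel, gOfH, h0]
  have h1 : (X - 1) * toricHBelow (e p) = X ^ coRank k p.1 - 1 := by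
    rw [X_sub_one_mul_toricHBelow hk hkn e p h0,
      sum_lt_eq p ((p.1.1.powerset ×ˢ p.1.2.powerset).erase p.1) ?_ _
        (fun q => (X - 1) ^ (p.1.1.card - q.1.card) * (X - 1) ^ (p.1.2.card - q.2.card)) ?_,
      Finset.sum_erase_eq_sub, Finset.sum_product]
    · simp only [← Finset.mul_sum, sum_powerset_pow, ← Finset.sum_mul]
      rw [coRank_of_isProper hp, pow_add]; simp
    · simp
    · intro q
      rw [Finset.mem_erase, Finset.mem_product, Finset.mem_powerset, Finset.mem_powerset,
        lt_iff_le_and_ne]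
      constructor
      · rintro ⟨hne, hle⟩
        exact ⟨Or.inl (isProper_of_le hp hle), hle, hne⟩
      · rintro ⟨-, hle, hne⟩
        exact ⟨hne, hle⟩
    · intro q hq
      have hqp := isProper_of_le hp (show q.1 ≤ p.1 from hq.le)
      rw [ih q hq hqp, coRank_of_isProper hp, coRank_of_isProper hqp, one_mul, ← pow_add]
      congr 1
      have h1 : q.1.1.card ≤ p.1.1.card := Finset.card_le_card hq.le.1
      have h2 : q.1.2.card ≤ p.1.2.card := Finset.card_le_card hq.le.2
      omega
  have h2 : toricHBelow (e p) = ∑ i ∈ Finset.range (coRank k p.1), X ^ i := by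
    apply mul_left_cancel₀ X_sub_one_ne_zero
    rw [h1, mul_geom_sum]
  rw [gModel, h2, gOfH, if_neg h0,
    Finset.sum_eq_zero (s := Finset.Icc _ _)]
  · simp [finsetSum_coeff, coeff_X_pow, Nat.pos_of_ne_zero h0]
  · intro i hi
    rw [Finset.mem_Icc] at hi
    have h3 : i < coRank k p.1 := by omega
    have h4 : i - 1 < coRank k p.1 := by omega
    simp [finsetSum_coeff, coeff_X_pow, h3, h4]

lemma sum_ssubsets_pow (s : Finset (Fin n)) :
    ∑ t ∈ s.ssubsets, (X - 1 : ℤ[X]) ^ (s.card - t.card) = X ^ s.card - 1 := by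
  rw [Finset.ssubsets, Finset.sum_erase_eq_sub (Finset.mem_powerset_self s), sum_powerset_pow]
  simp

lemma lt_isFacet_iff (hkn : k < n) {p q : Finset (Fin n) × Finset (Fin n)} (hp : IsFacet k p) :
    ((IsProper k q ∨ IsFacet k q ∨ q = (Finset.univ, Finset.univ)) ∧ q < p) ↔
      q.1 ⊂ p.1 ∧ q.2 ⊂ p.2 := by
  have hp2 : p.2.card = n - k := by rw [hp.2, Finset.card_compl, hp.1, Fintype.card_fin]
  have hp1 := hp.1
  constructor
  · rintro ⟨h | h | rfl, hlt⟩
    · have h1 := h.2.1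
      have h2 := h.2.2
      refine ⟨lt_of_le_of_ne hlt.le.1 fun h' => ?_, lt_of_le_of_ne hlt.le.2 fun h' => ?_⟩
      · rw [h'] at h1; omega
      · rw [h'] at h2; omega
    · have h2 : q.2.card = n - k := by rw [h.2, Finset.card_compl, h.1, Fintype.card_fin]
      have := card_add_card_lt hlt
      have := h.1
      omega
    · have := Finset.card_le_card hlt.le.1
      simp at this; omega
  · rintro ⟨h1, h2⟩
    exact ⟨Or.inl (isProper_of_ssubset_facet hkn hp h1 h2), Prod.lt_iff.2 (Or.inl ⟨h1, h2.subset⟩)⟩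

lemma gModel_isFacet (hk : 0 < k) (hkn : 2 * k ≤ n) (e : CoFace k n ≃o L)
    (p : CoFace k n) (hp : IsFacet k p.1) : gModel e p = ∑ i ∈ Finset.range k, X ^ i := by
  classical
  have hkn' : k < n := by omega
  have hrank := coRank_of_isFacet hp
  have h0 : coRank k p.1 ≠ 0 := by omega
  have hp2 : p.1.2.card = n - k := by rw [hp.2, Finset.card_compl, hp.1, Fintype.card_fin]
  have hp1 := hp.1
  -- A second factor `X - 1` raises the exponent to `n - |A| - |B| = (k - |A|) + (n - k - |B|)`, so
  -- the sum splits as a product.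
  have h1 : (X - 1) * ((X - 1) * toricHBelow (e p)) = (X ^ k - 1) * (X ^ (n - k) - 1) := by
    rw [X_sub_one_mul_toricHBelow hk hkn' e p h0,
      sum_lt_eq p (p.1.1.ssubsets ×ˢ p.1.2.ssubsets) ?_ _
        (fun q => (X - 1) ^ (n - 1 - (q.1.card + q.2.card))) ?_,
      Finset.mul_sum, ← hp2,
      show (X ^ k - 1 : ℤ[X]) = X ^ p.1.1.card - 1 by rw [hp1], ← sum_ssubsets_pow,
      ← sum_ssubsets_pow, Finset.sum_mul_sum, ← Finset.sum_product']
    · refine Finset.sum_congr rfl fun q hq => ?_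
      rw [Finset.mem_product, Finset.mem_ssubsets, Finset.mem_ssubsets] at hq
      have h1 := Finset.card_lt_card hq.1
      have h2 := Finset.card_lt_card hq.2
      rw [← pow_succ', ← pow_add]
      congr 1
      omega
    · intro q
      rw [lt_isFacet_iff hkn' hp, Finset.mem_product, Finset.mem_ssubsets, Finset.mem_ssubsets]
    · intro q hq
      have h := (lt_isFacet_iff hkn' hp).1 ⟨q.2, hq⟩
      have hq' := isProper_of_ssubset_facet hkn' hp h.1 h.2
      rw [gModel_isProper hk hkn' e q hq', hrank, coRank_of_isProper hq', one_mul]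
  have h2 : (X - 1) * toricHBelow (e p) =
      (X ^ k - 1) * ∑ i ∈ Finset.range (n - k), X ^ i := by
    apply mul_left_cancel₀ X_sub_one_ne_zero
    rw [h1, mul_left_comm, mul_geom_sum]
  -- Below degree `n - k` the differences of `h` are those of `(1 - X ^ k) * (1 + X + ⋯)`. As `2 * k
  -- ≤ n`, this covers every degree that `g` retains.
  have hd : ∀ i, i < n - k → (toricHBelow (e p)).coeff i -
      (X * toricHBelow (e p)).coeff i = if i < k then 1 else 0 := by
    intro i hi
    have h3 := congrArg (fun f => coeff f i) h2
    simp only [sub_mul, one_mul, coeff_sub, coeff_X_pow_mul', finsetSum_coeff, coeff_X_pow,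
      Finset.sum_ite_eq, Finset.mem_range, hi, if_true] at h3
    have h4 : i - k < n - k := by omega
    simp only [h4, if_true] at h3
    split_ifs at h3 ⊢ <;> omega
  rw [gModel, gOfH, if_neg h0, hrank]
  ext i
  simp only [coeff_add, coeff_C, finsetSum_coeff, coeff_C_mul, coeff_X_pow, mul_ite, mul_one,
    mul_zero, Finset.sum_ite_eq, Finset.mem_range, Finset.mem_Icc]
  rcases Nat.eq_zero_or_pos i with rfl | hi
  · have := hd 0 (by omega)
    simp only [coeff_X_mul_zero, sub_zero] at this
    simp [this]
  · obtain ⟨j, rfl⟩ := Nat.exists_eq_succ_of_ne_zero hi.ne'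
    by_cases hj : j + 1 < n - k
    · have := hd (j + 1) hj
      rw [coeff_X_mul] at this
      simp only [Nat.succ_eq_add_one, Nat.add_sub_cancel, this, Nat.add_eq_zero_iff, one_ne_zero, and_false,
        if_false, zero_add]
      split_ifs <;> first | rfl | omega
    · simp only [Nat.succ_eq_add_one, Nat.add_sub_cancel, Nat.add_eq_zero_iff, one_ne_zero,
        and_false, if_false, zero_add]
      split_ifs <;> first | rfl | omega

/-! ### Summation over pairs of disjoint sets -/

/-- The pairs of disjoint sets with a condition on the size of the first one. -/
lemma sum_disjoint_fst (P : ℕ → Prop) [DecidablePred P] :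
    ∑ q : Finset (Fin n) × Finset (Fin n),
      (if Disjoint q.1 q.2 ∧ P q.1.card then (X - 1 : ℤ[X]) ^ (n - (q.1.card + q.2.card)) else 0) =
    ∑ i ∈ Finset.range (n + 1), if P i then (n.choose i : ℤ[X]) * X ^ (n - i) else 0 := by
  rw [Fintype.sum_prod_type]
  have h1 : ∀ A : Finset (Fin n), ∑ B : Finset (Fin n),
      (if Disjoint A B ∧ P A.card then (X - 1 : ℤ[X]) ^ (n - (A.card + B.card)) else 0) =
      if P A.card then X ^ (n - A.card) else 0 := by
    intro A
    split_ifs with hA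
    · have hc : Aᶜ.card = n - A.card := by rw [Finset.card_compl, Fintype.card_fin]
      rw [← hc, ← sum_powerset_pow, ← Finset.sum_filter]
      refine Finset.sum_congr ?_ fun B _ => ?_
      · ext B
        simp [hA, Finset.subset_compl_iff_disjoint_left]
      · rw [hc, Nat.sub_add_eq]
    · exact Finset.sum_eq_zero fun B _ => if_neg fun h => hA h.2
  simp only [h1]
  have h2 := Finset.sum_powerset_apply_card
    (fun m => if P m then (X : ℤ[X]) ^ (n - m) else 0) (x := (Finset.univ : Finset (Fin n)))
  rw [Finset.powerset_univ, Finset.card_univ, Fintype.card_fin] at h2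
  rw [h2]
  refine Finset.sum_congr rfl fun i _ => ?_
  split_ifs <;> simp

lemma sum_disjoint_snd (P : ℕ → Prop) [DecidablePred P] :
    ∑ q : Finset (Fin n) × Finset (Fin n),
      (if Disjoint q.1 q.2 ∧ P q.2.card then (X - 1 : ℤ[X]) ^ (n - (q.1.card + q.2.card)) else 0) =
    ∑ i ∈ Finset.range (n + 1), if P i then (n.choose i : ℤ[X]) * X ^ (n - i) else 0 := by
  rw [← sum_disjoint_fst]
  refine Fintype.sum_equiv (Equiv.prodComm _ _) _ _ fun q => ?_
  simp only [Equiv.prodComm_apply, Prod.fst_swap, Prod.snd_swap, disjoint_comm, add_comm]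

open Classical in
lemma card_isFacet :
    (Finset.univ.filter (fun q : Finset (Fin n) × Finset (Fin n) => IsFacet k q)).card =
      n.choose k := by
  have : Finset.univ.filter (fun q : Finset (Fin n) × Finset (Fin n) => IsFacet k q) =
      (Finset.univ.powersetCard k).image (fun S => (S, Sᶜ)) := by
    ext ⟨A, B⟩
    rw [Finset.mem_filter]
    simp only [Finset.mem_univ, true_and, Finset.mem_image, Finset.mem_powersetCard,
      Finset.subset_univ, IsFacet, Prod.mk.injEq]
    constructor
    · rintro ⟨h, rfl⟩; exact ⟨A, h, rfl, rfl⟩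
    · rintro ⟨S, h, rfl, rfl⟩; exact ⟨h, rfl⟩
  rw [this, Finset.card_image_of_injective _ (fun S T h => (Prod.ext_iff.1 h).1)]
  simp

open Classical in
-- Among disjoint pairs with `|A| < k`, the improper ones are those with `|B| ≥ n - k`, except for
-- the facets, where `|A| = k`. So the sum is that over `|A| < k`, minus that over `|B| ≥ n - k`,
-- plus 1 for each facet.
lemma sum_isProper (hkn : k < n) :
    ∑ q ∈ Finset.univ.filter (fun q : Finset (Fin n) × Finset (Fin n) => IsProper k q),
      (X - 1 : ℤ[X]) ^ (n - (q.1.card + q.2.card)) =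
    ∑ i ∈ Finset.range k, (n.choose i : ℤ[X]) * X ^ (n - i)
      - ∑ i ∈ Finset.range (k + 1), (n.choose i : ℤ[X]) * X ^ i + n.choose k := by
  have h1 : ∑ i ∈ Finset.range k, (n.choose i : ℤ[X]) * X ^ (n - i) =
      ∑ i ∈ Finset.range (n + 1), if i < k then (n.choose i : ℤ[X]) * X ^ (n - i) else 0 := by
    rw [← Finset.sum_filter]
    congr 1
    ext i; simp only [Finset.mem_range, Finset.mem_filter]; omega
  have h2 : ∑ i ∈ Finset.range (k + 1), (n.choose i : ℤ[X]) * X ^ i =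
      ∑ i ∈ Finset.range (n + 1), if n ≤ i + k then (n.choose i : ℤ[X]) * X ^ (n - i) else 0 := by
    rw [← Finset.sum_filter]
    refine Finset.sum_bij' (fun i _ => n - i) (fun i _ => n - i) ?_ ?_ ?_ ?_ ?_
    · intro i hi; simp only [Finset.mem_range, Finset.mem_filter] at hi ⊢; omega
    · intro i hi; simp only [Finset.mem_range, Finset.mem_filter] at hi ⊢; omega
    · intro i hi; simp only [Finset.mem_range] at hi ⊢; omega
    · intro i hi; simp only [Finset.mem_range, Finset.mem_filter] at hi ⊢; omega
    · intro i hi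
      rw [Finset.mem_range] at hi
      have : i ≤ n := by omega
      rw [Nat.choose_symm this, Nat.sub_sub_self this]
  have h3 : (n.choose k : ℤ[X]) =
      ∑ q : Finset (Fin n) × Finset (Fin n), if IsFacet k q then (1 : ℤ[X]) else 0 := by
    rw [← Finset.sum_filter, Finset.sum_const, card_isFacet]; simp
  rw [h1, h2, h3, ← sum_disjoint_fst, ← sum_disjoint_snd (fun i => n ≤ i + k), Finset.sum_filter,
    ← Finset.sum_sub_distrib, ← Finset.sum_add_distrib]
  refine Finset.sum_congr rfl fun q _ => ?_
  by_cases hd : Disjoint q.1 q.2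
  · have hc : q.1.card + q.2.card ≤ n := by
      rw [← Finset.card_union_of_disjoint hd]
      simpa using Finset.card_le_univ (q.1 ∪ q.2)
    by_cases hf : IsFacet k q
    · have hq2 : q.2.card = n - k := by rw [hf.2, Finset.card_compl, hf.1, Fintype.card_fin]
      have hq1 := hf.1
      have e1 : ¬ IsProper k q := fun h => by have := h.2.1; omega
      have e2 : ¬ q.1.card < k := by omega
      have e3 : n ≤ q.2.card + k := by omega
      have e4 : n - (q.1.card + q.2.card) = 0 := by omega
      simp [e1, e2, e3, e4, hf, hd]
    · by_cases e2 : q.1.card < k <;> by_cases e3 : n ≤ q.2.card + k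
      · have e1 : ¬ IsProper k q := fun h => by have := h.2.2; omega
        simp [e1, e2, e3, hf, hd]
      · have e1 : IsProper k q := ⟨hd, e2, by omega⟩
        simp [e1, e2, e3, hf, hd]
      · refine absurd ⟨by omega, ?_⟩ hf
        refine Finset.eq_of_subset_of_card_le (Finset.subset_compl_iff_disjoint_left.2 hd) ?_
        rw [Finset.card_compl, Fintype.card_fin]; omega
      · have e1 : ¬ IsProper k q := fun h => e2 h.2.1
        simp [e1, e2, e3, hf]
  · have e1 : ¬ IsProper k q := fun h => hd h.1
    have e2 : ¬ IsFacet k q := fun h => hd (by rw [h.2]; exact disjoint_compl_right)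
    simp [e1, e2, hd]

/-- The `h`-polynomial of a lattice modelled by `CoFace k n`. -/
lemma toricHBelow_top (hk : 0 < k) (hkn : 2 * k ≤ n) (e : CoFace k n ≃o L) :
    toricHBelow (e ⟨(Finset.univ, Finset.univ), Or.inr (Or.inr rfl)⟩) =
      ∑ i ∈ Finset.range k, (n.choose i : ℤ[X]) * ∑ j ∈ Finset.Ico i (n - i), X ^ j := by
  classical
  have hkn' : k < n := by omega
  have hn : 0 < n := by omega
  have hPF : ∀ q : Finset (Fin n) × Finset (Fin n), IsProper k q → ¬ IsFacet k q :=
    fun q h h' => by have := h.2.1; have := h'.1; omega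
  apply mul_left_cancel₀ X_sub_one_ne_zero
  rw [X_sub_one_mul_toricHBelow hk hkn' e _ (by rw [coRank_top hn]; omega),
    sum_lt_eq _ (Finset.univ.filter (IsProper k) ∪ Finset.univ.filter (IsFacet k)) ?_ _
      (fun q => if IsProper k q then (X - 1) ^ (n - (q.1.card + q.2.card))
        else (∑ i ∈ Finset.range k, X ^ i) * (X - 1)) ?_,
    Finset.sum_union]
  · rw [Finset.sum_congr rfl (g := fun q : Finset (Fin n) × Finset (Fin n) =>
        (X - 1 : ℤ[X]) ^ (n - (q.1.card + q.2.card))) (fun q hq => if_pos (Finset.mem_filter.1 hq).2),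
      Finset.sum_congr rfl (g := fun q => (∑ i ∈ Finset.range k, X ^ i) * (X - 1 : ℤ[X]))
        (fun q hq => if_neg fun h => hPF q h (Finset.mem_filter.1 hq).2),
      sum_isProper hkn', Finset.sum_const, card_isFacet, geom_sum_mul, Finset.mul_sum,
      Finset.sum_range_succ]
    have : ∀ i ∈ Finset.range k, (X - 1 : ℤ[X]) * ((n.choose i : ℤ[X]) *
        ∑ j ∈ Finset.Ico i (n - i), X ^ j) =
        (n.choose i : ℤ[X]) * X ^ (n - i) - (n.choose i : ℤ[X]) * X ^ i := by
      intro i hi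
      rw [Finset.mem_range] at hi
      rw [mul_left_comm, mul_comm (X - 1 : ℤ[X]), geom_sum_Ico_mul _ (by omega), mul_sub]
    rw [Finset.sum_congr rfl this, Finset.sum_sub_distrib, nsmul_eq_mul]
    -- The facets contribute `C(n,k) (X ^ k - 1)`, cancelling the terms for `k` left by
    -- `sum_isProper`.
    ring
  · rw [Finset.disjoint_filter]
    exact fun q _ => hPF q
  · intro q
    simp only [Finset.mem_union, Finset.mem_filter, Finset.mem_univ, true_and]
    have htop : ∀ q : Finset (Fin n) × Finset (Fin n), q ≤ (Finset.univ, Finset.univ) :=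
      fun q => ⟨Finset.subset_univ _, Finset.subset_univ _⟩
    constructor
    · intro h
      refine ⟨by tauto, lt_of_le_of_ne (htop q) ?_⟩
      rintro rfl
      rcases h with h | h
      · have := h.2.1; simp at this; omega
      · have := h.1; simp at this; omega
    · rintro ⟨h | h | h, hlt⟩
      · exact Or.inl h
      · exact Or.inr h
      · exact absurd h hlt.ne
  · intro q hq
    simp only [coRank_top hn]
    rcases q.2 with h | h | h
    · rw [if_pos h, gModel_isProper hk hkn' e q h, coRank_of_isProper h, one_mul]
    · rw [if_neg fun h' => hPF _ h' h, gModel_isFacet hk hkn e q h, coRank_of_isFacet h,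
        Nat.sub_sub_self hn, pow_one]
    · exact absurd (Subtype.ext h) hq.ne

lemma coeff_model (r : ℕ) :
    (∑ i ∈ Finset.range k, (n.choose i : ℤ[X]) * ∑ j ∈ Finset.Ico i (n - i), X ^ j).coeff r =
      ∑ i ∈ Finset.range k, if i ≤ r ∧ r < n - i then (n.choose i : ℤ) else 0 := by
  rw [finsetSum_coeff]
  refine Finset.sum_congr rfl fun i _ => ?_
  rw [← C_eq_natCast, coeff_C_mul, finsetSum_coeff]
  simp [coeff_X_pow]

end Model

/-! ### Convexity: tight inequalities and relative interiors -/

/-- A nonempty exposed face of a polyhedron is cut out by the inequalities that are tight at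
one of its points. -/
lemma exposed_eq_of_tight {E ι : Type*} [AddCommGroup E] [TopologicalSpace E] [Module ℝ E]
    [Finite ι] (D : Submodule ℝ E) (a : ι → E →L[ℝ] ℝ) {Q B : Set E}
    (hQ : ∀ y, y ∈ Q ↔ y ∈ D ∧ ∀ s, a s y ≤ 1) (hB : IsExposed ℝ Q B) (hne : B.Nonempty) :
    ∃ y₀ ∈ Q, B = {y | y ∈ Q ∧ ∀ s, a s y₀ = 1 → a s y = 1} := by
  classical
  have := Fintype.ofFinite ι
  obtain ⟨l, hl⟩ := hB hne
  let T : E → Finset ι := fun y => Finset.univ.filter fun s => a s y = 1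
  -- A point with fewest tight inequalities works: its midpoint with any `y ∈ B` lies in `B` and is
  -- tight only where both endpoints are.
  obtain ⟨y₀, hy₀, hmin⟩ : ∃ y₀ ∈ B, ∀ y ∈ B, T y₀ ⊆ T y := by
    obtain ⟨y₀, hy₀, hmin⟩ :=
      (measure fun y => (T y).card).wf.has_min B hne
    refine ⟨y₀, hy₀, fun y hy => ?_⟩
    have hBQ : ∀ z ∈ B, z ∈ Q ∧ ∀ x ∈ Q, l x ≤ l z := fun z hz => by rw [hl] at hz; exact hz
    have h0 := hBQ y₀ hy₀
    have h1 := hBQ y hy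
    have h0Q := (hQ _).1 h0.1
    have h1Q := (hQ _).1 h1.1
    let z : E := (1 / 2 : ℝ) • y₀ + (1 / 2 : ℝ) • y
    have haz : ∀ s, a s z = (a s y₀ + a s y) / 2 := fun s => by
      simp only [z, map_add, map_smul, smul_eq_mul]; ring
    have hzB : z ∈ B := by
      rw [hl]
      refine ⟨(hQ _).2 ⟨D.add_mem (D.smul_mem _ h0Q.1) (D.smul_mem _ h1Q.1), fun s => ?_⟩,
        fun x hx => ?_⟩
      · rw [haz]; linarith [h0Q.2 s, h1Q.2 s]
      · have : l z = (l y₀ + l y) / 2 := by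
          simp only [z, map_add, map_smul, smul_eq_mul]; ring
        rw [this]; linarith [h0.2 x hx, h1.2 x hx]
    have hT : ∀ s ∈ T z, s ∈ T y₀ ∧ s ∈ T y := fun s hs => by
      simp only [T, Finset.mem_filter, Finset.mem_univ, true_and, haz] at hs ⊢
      constructor <;> linarith [h0Q.2 s, h1Q.2 s]
    have hzT : T z = T y₀ := Finset.eq_of_subset_of_card_le (fun s hs => (hT s hs).1)
      (not_lt.1 (hmin z hzB))
    exact fun s hs => (hT s (hzT ▸ hs)).2
  have h0 : y₀ ∈ Q ∧ ∀ x ∈ Q, l x ≤ l y₀ := by rw [hl] at hy₀; exact hy₀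
  have h0Q := (hQ _).1 h0.1
  refine ⟨y₀, h0.1, Set.Subset.antisymm (fun y hy => ⟨?_, fun s hs => ?_⟩) ?_⟩
  · rw [hl] at hy; exact hy.1
  · have := hmin y hy (Finset.mem_filter.2 ⟨Finset.mem_univ s, hs⟩)
    exact (Finset.mem_filter.1 this).2
  rintro z ⟨hzQ, hz⟩
  have hzQ' := (hQ _).1 hzQ
  -- The segment from `z` can be prolonged past `y₀` inside `Q`: inequalities tight at `y₀` are
  -- constant along it, the others have slack. Maximality of `l` at `y₀` then forces `l y₀ ≤ l z`.
  obtain ⟨ε, hε, hεs⟩ : ∃ ε : ℝ, 0 < ε ∧ ∀ s, a s y₀ + ε * (a s y₀ - a s z) ≤ 1 := by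
    have hev : ∀ s, ∀ᶠ ε in nhdsWithin (0 : ℝ) (Set.Ioi 0),
        a s y₀ + ε * (a s y₀ - a s z) ≤ 1 := by
      intro s
      rcases (h0Q.2 s).eq_or_lt with h | h
      · exact Filter.Eventually.of_forall fun ε => by rw [hz s h, h]; simp
      · have hc : Filter.Tendsto (fun ε : ℝ => a s y₀ + ε * (a s y₀ - a s z)) (nhds 0)
            (nhds (a s y₀ + 0 * (a s y₀ - a s z))) :=
          Continuous.tendsto (by fun_prop) 0
        have := hc.eventually_lt_const (u := 1) (by simpa using h)
        exact (this.filter_mono nhdsWithin_le_nhds).mono fun _ h => le_of_lt h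
    obtain ⟨ε, h1, h2⟩ :=
      ((Filter.eventually_all.2 hev).and self_mem_nhdsWithin).exists
    exact ⟨ε, h2, h1⟩
  have hx : y₀ + ε • (y₀ - z) ∈ Q := by
    refine (hQ _).2 ⟨D.add_mem h0Q.1 (D.smul_mem _ (D.sub_mem h0Q.1 hzQ'.1)), fun s => ?_⟩
    simpa only [map_add, map_smul, map_sub, smul_eq_mul] using hεs s
  have h3 := h0.2 _ hx
  simp only [map_add, map_smul, map_sub, smul_eq_mul] at h3
  have h4 : l y₀ ≤ l z := by
    by_contra h
    have := mul_pos hε (sub_pos.2 (not_le.1 h))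
    linarith
  rw [hl]
  exact ⟨hzQ, fun x hx => (h0.2 x hx).trans h4⟩

/-- An affine functional that is bounded on `s` and attains its bound at a point of the
intrinsic interior is constant on `s`. -/
lemma le_apply_of_mem_intrinsicInterior {E : Type*} [NormedAddCommGroup E] [NormedSpace ℝ E]
    {s : Set E} {c : E} (hc : c ∈ intrinsicInterior ℝ s) (f : E →L[ℝ] ℝ) {m : ℝ}
    (hf : ∀ x ∈ s, f x ≤ m) (hm : m ≤ f c) {v : E} (hv : v ∈ s) : m ≤ f v := by
  obtain ⟨y, hy, rfl⟩ := mem_intrinsicInterior.1 hc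
  have hvs : v ∈ affineSpan ℝ s := subset_affineSpan ℝ s hv
  let g : ℝ → affineSpan ℝ s := fun t =>
    ⟨AffineMap.lineMap (y : E) v (-t), AffineMap.lineMap_mem _ y.2 hvs⟩
  have hg : Continuous g := by
    refine Continuous.subtype_mk ?_ _
    simp only [AffineMap.lineMap_apply_module]
    fun_prop
  have hg0 : g 0 = y := Subtype.ext (by simp [g])
  have h1 : ∀ᶠ t in nhdsWithin (0 : ℝ) (Set.Ioi 0), g t ∈ interior (Subtype.val ⁻¹' s) :=
    (hg.continuousAt.eventually (isOpen_interior.mem_nhds (hg0 ▸ hy))).filter_mono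
      nhdsWithin_le_nhds
  obtain ⟨t, ht, ht0⟩ := (h1.and self_mem_nhdsWithin).exists
  have h2 := hf (g t) (interior_subset ht :)
  have h3 : f (g t) = f y + t * (f y - f v) := by
    simp only [g, AffineMap.lineMap_apply_module, map_add, map_smul, smul_eq_mul]; ring
  rw [h3] at h2
  by_contra h
  have := mul_pos (show 0 < t from ht0) (show 0 < f y - f v by linarith)
  linarith

/-! ### Maximizers of a weight on the `k`-subsets -/

/-- An upper bound for the weight of a set in terms of a threshold, and the case of equality. -/
lemma sum_le_threshold {n : ℕ} (w : Fin n → ℝ) (t : ℝ) (S : Finset (Fin n)) :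
    ∑ i ∈ S, w i ≤ ∑ i, max (w i - t) 0 + S.card * t ∧
    (∑ i ∈ S, w i = ∑ i, max (w i - t) 0 + S.card * t ↔
      ∀ i, (t < w i → i ∈ S) ∧ (w i < t → i ∉ S)) := by
  have h1 : ∑ i, max (w i - t) 0 + S.card * t - ∑ i ∈ S, w i =
      ∑ i, (max (w i - t) 0 - if i ∈ S then w i - t else 0) := by
    rw [Finset.sum_sub_distrib, ← Finset.sum_filter, Finset.filter_mem_eq_inter,
      Finset.univ_inter, Finset.sum_sub_distrib]
    simp; ring
  have h2 : ∀ i ∈ Finset.univ, 0 ≤ max (w i - t) 0 - if i ∈ S then w i - t else 0 := by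
    intro i _
    split_ifs
    · linarith [le_max_left (w i - t) 0]
    · linarith [le_max_right (w i - t) 0]
  constructor
  · linarith [Finset.sum_nonneg h2]
  · rw [eq_comm, ← sub_eq_zero, h1, Finset.sum_eq_zero_iff_of_nonneg h2]
    simp only [Finset.mem_univ, true_implies]
    refine forall_congr' fun i => ?_
    by_cases hi : i ∈ S
    · simp only [hi, if_true, sub_eq_zero, max_eq_left_iff, sub_nonneg, implies_true, true_and,
        not_true_eq_false, imp_false, not_lt]
    · simp only [hi, if_false, sub_zero, max_eq_right_iff, sub_nonpos, imp_false, not_lt,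
        not_false_eq_true, implies_true, and_true]

/-- The `k`-subsets that contain `p.1` and avoid `p.2` are the vertices of the face of the
hypersimplex described by `p`. -/
def Supports {n : ℕ} (p : Finset (Fin n) × Finset (Fin n)) (S : Finset (Fin n)) : Prop :=
  p.1 ⊆ S ∧ Disjoint p.2 S

lemma not_supports_univ {n : ℕ} (hn : 0 < n) (S : Finset (Fin n)) :
    ¬ Supports (Finset.univ, Finset.univ) S := by
  rintro ⟨h1, h2⟩
  have i : Fin n := ⟨0, hn⟩
  exact Finset.disjoint_left.1 h2 (Finset.mem_univ i) (h1 (Finset.mem_univ i))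

/-- For proper `q` there is room to choose a `k`-subset supporting `q` that omits any given element
outside `q.1`, or contains any given element outside `q.2`. Hence the supporting sets determine the
pair. -/
lemma le_of_supports {k n : ℕ} {p q : CoFace k n}
    (h : ∀ S : Finset (Fin n), S.card = k → Supports q.1 S → Supports p.1 S) : p ≤ q := by
  obtain ⟨q, hq | hq | rfl⟩ := q
  · have hcompl : q.1 ⊆ q.2ᶜ := Finset.subset_compl_iff_disjoint_right.2 hq.1
    have hc : q.2ᶜ.card = n - q.2.card := by rw [Finset.card_compl, Fintype.card_fin]
    have h1 := hq.2.1
    have h2 := hq.2.2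
    constructor
    · intro i hi
      by_contra hiq
      obtain ⟨S, hS1, hS2, hS⟩ := Finset.exists_subsuperset_card_eq (n := k)
        (show q.1 ⊆ q.2ᶜ.erase i from Finset.subset_erase.2 ⟨hcompl, hiq⟩) h1.le
        (by have := Finset.pred_card_le_card_erase (s := q.2ᶜ) (a := i); omega)
      have hd : Disjoint q.2 S :=
        Finset.subset_compl_iff_disjoint_left.1 (hS2.trans (Finset.erase_subset _ _))
      exact Finset.notMem_erase i _ (hS2 ((h S hS ⟨hS1, hd⟩).1 hi))
    · intro i hi
      by_contra hiq
      obtain ⟨S, hS1, hS2, hS⟩ := Finset.exists_subsuperset_card_eq (n := k)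
        (show insert i q.1 ⊆ q.2ᶜ from Finset.insert_subset (Finset.mem_compl.2 hiq) hcompl)
        (by have := Finset.card_insert_le i q.1; omega) (by omega)
      have hd : Disjoint q.2 S := Finset.subset_compl_iff_disjoint_left.1 hS2
      exact Finset.disjoint_left.1
        (h S hS ⟨(Finset.subset_insert _ _).trans hS1, hd⟩).2 hi
        (hS1 (Finset.mem_insert_self _ _))
  · obtain ⟨h1, h2⟩ := h q.1 hq.1 ⟨Finset.Subset.refl _, by rw [hq.2]; exact disjoint_compl_left⟩
    exact ⟨h1, show p.1.2 ⊆ q.2 by rw [hq.2]; exact Finset.subset_compl_iff_disjoint_right.2 h2⟩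
  · exact ⟨Finset.subset_univ _, Finset.subset_univ _⟩

/-- The sets of maximizers of a weight function on the `k`-subsets. -/
lemma exists_supports_of_max {k n : ℕ} (hk : 0 < k) (hkn : k < n) (w : Fin n → ℝ)
    {S₀ : Finset (Fin n)} (h0 : S₀.card = k)
    (hmax : ∀ S : Finset (Fin n), S.card = k → ∑ i ∈ S, w i ≤ ∑ i ∈ S₀, w i) :
    ∃ p : CoFace k n, ∀ S : Finset (Fin n), S.card = k →
      (∑ i ∈ S, w i = ∑ i ∈ S₀, w i ↔ Supports p.1 S) := by
  have hc0 : S₀ᶜ.card = n - k := by rw [Finset.card_compl, h0, Fintype.card_fin]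
  obtain ⟨i, hi, himin⟩ := Finset.exists_min_image S₀ w (Finset.card_pos.1 (by omega))
  obtain ⟨j, hj, hjmax⟩ := Finset.exists_max_image S₀ᶜ w (Finset.card_pos.1 (by omega))
  have hjS : j ∉ S₀ := Finset.mem_compl.1 hj
  -- Otherwise exchanging `i` for `j` would increase the weight of `S₀`.
  have hji : w j ≤ w i := by
    have hj' : j ∉ S₀.erase i := fun h => hjS (Finset.mem_of_mem_erase h)
    have := hmax (insert j (S₀.erase i))
      (by rw [Finset.card_insert_of_notMem hj', Finset.card_erase_add_one hi, h0])
    rw [Finset.sum_insert hj', ← Finset.add_sum_erase _ _ hi] at this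
    linarith
  have key : ∀ t, w j ≤ t → t ≤ w i → ∀ S : Finset (Fin n), S.card = k →
      (∑ l ∈ S, w l = ∑ l ∈ S₀, w l ↔ ∀ l, (t < w l → l ∈ S) ∧ (w l < t → l ∉ S)) := by
    intro t hjt hti S hS
    rw [← (sum_le_threshold w t S).2, (sum_le_threshold w t S₀).2.2, hS, h0]
    intro l
    refine ⟨fun hl => ?_, fun hl hlS => ?_⟩
    · by_contra hlS
      linarith [hjmax l (Finset.mem_compl.2 hlS)]
    · linarith [himin l hlS]
  -- In a tie, the elements strictly above and strictly below the common value are forced; `i` and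
  -- `j` stay free, so the pair is proper. With a gap, `S₀` is the only maximizer.
  rcases hji.eq_or_lt with he | hlt
  · have hA : Finset.univ.filter (fun l => w i < w l) ⊂ S₀ := by
      refine (Finset.ssubset_iff_of_subset fun l hl => ?_).2 ⟨i, hi, by simp⟩
      by_contra hlS
      have := (Finset.mem_filter.1 hl).2
      linarith [hjmax l (Finset.mem_compl.2 hlS)]
    have hB : Finset.univ.filter (fun l => w l < w i) ⊂ S₀ᶜ := by
      refine (Finset.ssubset_iff_of_subset fun l hl => ?_).2 ⟨j, hj, by simp [he]⟩
      refine Finset.mem_compl.2 fun hlS => ?_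
      have := (Finset.mem_filter.1 hl).2
      linarith [himin l hlS]
    refine ⟨⟨(Finset.univ.filter (fun l => w i < w l), Finset.univ.filter (fun l => w l < w i)),
      Or.inl ⟨disjoint_compl_right.mono hA.subset hB.subset, ?_, ?_⟩⟩, fun S hS => ?_⟩
    · simpa only [h0] using Finset.card_lt_card hA
    · have := Finset.card_lt_card hB
      simp only; omega
    · rw [key (w i) hji le_rfl S hS, forall_and, Supports]
      simp [Finset.subset_iff, Finset.disjoint_left]
  · refine ⟨⟨(S₀, S₀ᶜ), Or.inr (Or.inl ⟨h0, rfl⟩)⟩, fun S hS => ?_⟩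
    rw [key ((w i + w j) / 2) (by linarith) (by linarith) S hS, forall_and, Supports,
      Finset.disjoint_left]
    refine and_congr (forall_congr' fun l => imp_congr_left ?_)
      (forall_congr' fun l => imp_congr_left ?_)
    · refine ⟨fun h => ?_, fun h => by linarith [himin l h]⟩
      by_contra hlS
      linarith [hjmax l (Finset.mem_compl.2 hlS)]
    · refine ⟨fun h => Finset.mem_compl.2 fun hlS => ?_, fun h => by linarith [hjmax l h]⟩
      linarith [himin l hlS]

/-! ### Vertices of the hypersimplex and inequalities of its dual -/

/-- The indicator vector of a finset. -/
noncomputable def vert {n : ℕ} (S : Finset (Fin n)) : EuclideanSpace ℝ (Fin n) :=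
  WithLp.toLp 2 fun i => if i ∈ S then 1 else 0

lemma inner_vert {n : ℕ} (S : Finset (Fin n)) (y : EuclideanSpace ℝ (Fin n)) :
    inner ℝ (vert S) y = ∑ i ∈ S, y i := by
  simp [PiLp.inner_apply, vert]

lemma hypersimplex_eq (k n : ℕ) :
    hypersimplex k n = convexHull ℝ {v | ∃ S : Finset (Fin n), S.card = k ∧ vert S = v} := by
  unfold hypersimplex
  congr 1
  ext v
  constructor
  · rintro ⟨h1, h2⟩
    refine ⟨Finset.univ.filter fun i => v i = 1, ?_, ?_⟩
    · rw [← h2, ← Set.ncard_coe_finset]; simp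
    · ext i
      rcases h1 i with h | h <;> simp [vert, h]
  · rintro ⟨S, hS, rfl⟩
    constructor
    · intro i
      by_cases h : i ∈ S <;> simp [vert, h]
    · rw [← hS, ← Set.ncard_coe_finset]
      congr 1
      ext i
      simp [vert]

lemma vert_mem {k n : ℕ} {S : Finset (Fin n)} (hS : S.card = k) : vert S ∈ hypersimplex k n := by
  rw [hypersimplex_eq]
  exact subset_convexHull ℝ _ ⟨S, hS, rfl⟩

/-- A linear functional is bounded on the hypersimplex by its bound on the vertices. -/
lemma apply_le_of_vert {k n : ℕ} (f : EuclideanSpace ℝ (Fin n) →L[ℝ] ℝ) {m : ℝ}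
    (h : ∀ S : Finset (Fin n), S.card = k → f (vert S) ≤ m) :
    ∀ x ∈ hypersimplex k n, f x ≤ m := by
  intro x hx
  rw [hypersimplex_eq] at hx
  have : convexHull ℝ {v | ∃ S : Finset (Fin n), S.card = k ∧ vert S = v} ⊆ {x | f x ≤ m} :=
    convexHull_min (by rintro _ ⟨S, hS, rfl⟩; exact h S hS)
      (convex_halfSpace_le f.toLinearMap.isLinear m)
  exact this hx

/-- The functional whose value at most `1` is the inequality of the dual polytope given by the
vertex `vert S`. -/
noncomputable def ineq {n : ℕ} (c : EuclideanSpace ℝ (Fin n)) (S : Finset (Fin n)) :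
    EuclideanSpace ℝ (Fin n) →L[ℝ] ℝ :=
  innerSL ℝ (vert S - c)

lemma ineq_apply {n : ℕ} (c y : EuclideanSpace ℝ (Fin n)) (S : Finset (Fin n)) :
    ineq c S y = ∑ i ∈ S, y i - inner ℝ c y := by
  rw [ineq, innerSL_apply_apply, inner_sub_left, inner_vert]

lemma mem_dualPolytope {k n : ℕ} (c y : EuclideanSpace ℝ (Fin n)) :
    y ∈ dualPolytope (hypersimplex k n) c ↔
      y ∈ (affineSpan ℝ (hypersimplex k n)).direction ∧
        ∀ S : {S : Finset (Fin n) // S.card = k}, ineq c S.1 y ≤ 1 := by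
  refine and_congr_right fun _ => ⟨fun h S => ?_, fun h x hx => ?_⟩
  · have := h _ (vert_mem S.2)
    rwa [real_inner_comm] at this
  · have := apply_le_of_vert (k := k) (innerSL ℝ y) (m := 1 + inner ℝ y c) (fun S hS => ?_) x hx
    · rw [innerSL_apply_apply] at this
      rw [inner_sub_right]; linarith
    · have := h ⟨S, hS⟩
      rw [ineq, innerSL_apply_apply, real_inner_comm, inner_sub_right] at this
      rw [innerSL_apply_apply]; linarith

/-! ### The face lattice of the dual hypersimplex -/

section Iso

variable {k n : ℕ} {c : EuclideanSpace ℝ (Fin n)}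

/-- The face of the dual hypersimplex on which the inequalities of the vertices of the face `p`
of the hypersimplex are tight. -/
def dualFace (c : EuclideanSpace ℝ (Fin n)) (p : CoFace k n) : Set (EuclideanSpace ℝ (Fin n)) :=
  {y | y ∈ dualPolytope (hypersimplex k n) c ∧
    ∀ S : {S : Finset (Fin n) // S.card = k}, Supports p.1 S.1 → ineq c S.1 y = 1}

/-- The sum of the tight functionals exposes the face: given a point where all equal 1, its maximum
is attained exactly where each summand is 1. -/
lemma isExposed_dualFace (p : CoFace k n) :
    IsExposed ℝ (dualPolytope (hypersimplex k n) c) (dualFace c p) := by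
  classical
  rintro ⟨y₀, hy₀, hy₀'⟩
  let T := Finset.univ.filter fun S : {S : Finset (Fin n) // S.card = k} => Supports p.1 S.1
  have hle : ∀ y ∈ dualPolytope (hypersimplex k n) c, ∀ S ∈ T, ineq c S.1 y ≤ 1 :=
    fun y hy S _ => ((mem_dualPolytope c y).1 hy).2 S
  have h0 : (∑ S ∈ T, ineq c S.1) y₀ = ∑ S ∈ T, 1 := by
    rw [sum_apply]
    exact Finset.sum_congr rfl fun S hS => hy₀' S (Finset.mem_filter.1 hS).2
  refine ⟨∑ S ∈ T, ineq c S.1, Set.ext fun y => and_congr_right fun hy => ?_⟩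
  constructor
  · intro h z hz
    rw [sum_apply, sum_apply]
    exact Finset.sum_le_sum fun S hS =>
      (hle z hz S hS).trans (h S (Finset.mem_filter.1 hS).2).ge
  · intro h S hS
    have h1 := h y₀ hy₀
    rw [h0, sum_apply] at h1
    exact (Finset.sum_eq_sum_iff_of_le (hle y hy)).1
      (le_antisymm (Finset.sum_le_sum (hle y hy)) h1) S
      (Finset.mem_filter.2 ⟨Finset.mem_univ _, hS⟩)

/-- The pair `(∅, ∅)`, the least element of `CoFace k n`. -/
def coBot (hk : 0 < k) (hkn : k < n) : CoFace k n :=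
  ⟨(∅, ∅), Or.inl ⟨Finset.disjoint_empty_left _, by simpa using hk, by simpa using hkn⟩⟩

lemma coBot_le (hk : 0 < k) (hkn : k < n) (p : CoFace k n) : coBot hk hkn ≤ p :=
  ⟨Finset.empty_subset _, Finset.empty_subset _⟩

/-- If all vertex inequalities were tight at `y`, then `⟨y, x - c⟩` would be 1 throughout the
hypersimplex, contradicting its value 0 at `x = c`. -/
lemma dualFace_coBot (hk : 0 < k) (hkn : k < n) (hc : c ∈ hypersimplex k n) :
    dualFace c (coBot hk hkn) = ∅ := by
  refine Set.eq_empty_of_forall_notMem fun y hy => ?_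
  have h1 : ∀ S : Finset (Fin n), S.card = k → (-innerSL ℝ y) (vert S) ≤ -(1 + inner ℝ y c) := by
    intro S hS
    have := hy.2 ⟨S, hS⟩ ⟨Finset.empty_subset _, Finset.disjoint_empty_left _⟩
    rw [ineq, innerSL_apply_apply, real_inner_comm, inner_sub_right] at this
    rw [neg_apply, innerSL_apply_apply]; linarith
  have := apply_le_of_vert _ h1 c hc
  rw [neg_apply, innerSL_apply_apply] at this
  linarith

/-- A point of the dual hypersimplex at which exactly the inequalities of the vertices of the
face `p` are tight. -/
lemma exists_tight (hk : 0 < k) (hkn : k < n)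
    (hc : c ∈ intrinsicInterior ℝ (hypersimplex k n)) (p : CoFace k n)
    (hp : ¬ p ≤ coBot hk hkn) :
    ∃ y ∈ dualPolytope (hypersimplex k n) c,
      ∀ S : Finset (Fin n), S.card = k → (ineq c S y = 1 ↔ Supports p.1 S) := by
  by_cases hd : Disjoint p.1.1 p.1.2
  swap
  · have htop : p.1 = (Finset.univ, Finset.univ) := by
      rcases p.2 with h | h | h
      · exact absurd h.1 hd
      · exact absurd (by rw [h.2]; exact disjoint_compl_right) hd
      · exact h
    refine ⟨0, (mem_dualPolytope c 0).2 ⟨Submodule.zero_mem _, fun S => by simp⟩, fun S _ => ?_⟩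
    rw [htop]
    simp [not_supports_univ (by omega : 0 < n) S]
  -- With threshold 0, the weight `1_A - 1_B` reaches its bound `m` exactly on the sets supporting
  -- `p`.
  let u : EuclideanSpace ℝ (Fin n) :=
    WithLp.toLp 2 fun i => if i ∈ p.1.1 then 1 else if i ∈ p.1.2 then -1 else 0
  have hpos : ∀ i, 0 < u i ↔ i ∈ p.1.1 := by
    intro i
    simp only [u]
    split_ifs <;> simp_all
  have hneg : ∀ i, u i < 0 ↔ i ∈ p.1.2 := by
    intro i
    have := fun h : i ∈ p.1.1 => Finset.disjoint_left.1 hd h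
    simp only [u]
    split_ifs <;> simp_all [not_lt.2 (zero_le_one (α := ℝ))]
  obtain ⟨m, hm⟩ : ∃ m : ℝ, m = ∑ i, max (u i - 0) 0 := ⟨_, rfl⟩
  have hle : ∀ S : Finset (Fin n), ∑ i ∈ S, u i ≤ m := fun S => by
    have := (sum_le_threshold u 0 S).1
    rwa [← hm, mul_zero, add_zero] at this
  have heq : ∀ S : Finset (Fin n), ∑ i ∈ S, u i = m ↔ Supports p.1 S := fun S => by
    have := (sum_le_threshold u 0 S).2
    rw [← hm, mul_zero, add_zero] at this
    rw [this, forall_and, Supports, Finset.disjoint_left]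
    simp only [hpos, hneg]
    rfl
  -- If the bound were attained at the relative interior point `c`, it would be attained at every
  -- vertex; then every `k`-subset would support `p`, making `p` the bottom.
  have hM : inner ℝ c u < m := by
    by_contra hcon
    refine hp (le_of_supports fun S hS _ => (heq S).1 (le_antisymm (hle S) ?_))
    have := le_apply_of_mem_intrinsicInterior hc (innerSL ℝ u) (m := m)
      (apply_le_of_vert _ fun S _ => by
        rw [innerSL_apply_apply, real_inner_comm, inner_vert]; exact hle S)
      (by rw [innerSL_apply_apply, real_inner_comm]; exact not_lt.1 hcon) (vert_mem hS)
    rwa [innerSL_apply_apply, real_inner_comm, inner_vert] at this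
  have hM' : 0 < m - inner ℝ c u := sub_pos.2 hM
  let D := (affineSpan ℝ (hypersimplex k n)).direction
  -- Projecting `u` to the direction space does not change its pairing with `vert S - c`; the
  -- scaling makes the maximal value 1.
  have hval : ∀ S : Finset (Fin n), S.card = k →
      ineq c S ((m - inner ℝ c u)⁻¹ • D.starProjection u) =
        (∑ i ∈ S, u i - inner ℝ c u) / (m - inner ℝ c u) := by
    intro S hS
    have hmem : vert S - c ∈ D := AffineSubspace.vsub_mem_direction
      (subset_affineSpan ℝ _ (vert_mem hS))
      (subset_affineSpan ℝ _ (intrinsicInterior_subset hc))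
    rw [map_smul, smul_eq_mul, ← ineq_apply, ineq, innerSL_apply_apply, innerSL_apply_apply,
      ← Submodule.inner_starProjection_left_eq_right, Submodule.starProjection_eq_self_iff.2 hmem,
      div_eq_inv_mul]
  refine ⟨(m - inner ℝ c u)⁻¹ • D.starProjection u, (mem_dualPolytope c _).2
    ⟨D.smul_mem _ (Submodule.starProjection_apply_mem _ _), fun S => ?_⟩, fun S hS => ?_⟩
  · rw [hval S.1 S.2, div_le_one hM']
    linarith [hle S.1]
  · rw [hval S hS, div_eq_one_iff_eq hM'.ne', sub_left_inj, heq]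

lemma dualFace_subset_iff (hk : 0 < k) (hkn : k < n)
    (hc : c ∈ intrinsicInterior ℝ (hypersimplex k n)) (p q : CoFace k n) :
    dualFace c p ⊆ dualFace c q ↔ p ≤ q := by
  constructor
  · intro h
    by_cases hp : p ≤ coBot hk hkn
    · exact hp.trans (coBot_le hk hkn q)
    · obtain ⟨y, hy, hyS⟩ := exists_tight hk hkn hc p hp
      have hyq := h ⟨hy, fun S hS => (hyS S.1 S.2).2 hS⟩
      exact le_of_supports fun S hS hSq => (hyS S hS).1 (hyq.2 ⟨S, hS⟩ hSq)
  · rintro h y ⟨hy, hyS⟩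
    exact ⟨hy, fun S hS => hyS S ⟨h.1.trans hS.1, hS.2.mono_left h.2⟩⟩

/-- At a point `y₀` of the dual with some tight inequality, the tight sets are the `k`-subsets of
maximal `y₀`-weight. With none tight, the face is the whole dual. -/
lemma exists_eq_dualFace (hk : 0 < k) (hkn : k < n) (hc : c ∈ hypersimplex k n)
    {B : Set (EuclideanSpace ℝ (Fin n))}
    (hB : IsExposed ℝ (dualPolytope (hypersimplex k n) c) B) :
    ∃ p : CoFace k n, dualFace c p = B := by
  rcases B.eq_empty_or_nonempty with rfl | hne
  · exact ⟨coBot hk hkn, dualFace_coBot hk hkn hc⟩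
  obtain ⟨y₀, hy₀, rfl⟩ := exposed_eq_of_tight _
    (fun S : {S : Finset (Fin n) // S.card = k} => ineq c S.1) (mem_dualPolytope c) hB hne
  suffices h : ∃ p : CoFace k n, ∀ S : {S : Finset (Fin n) // S.card = k},
      ineq c S.1 y₀ = 1 ↔ Supports p.1 S.1 by
    obtain ⟨p, hp⟩ := h
    refine ⟨p, ?_⟩
    simp only [dualFace, hp]
  by_cases h : ∃ S₀ : {S : Finset (Fin n) // S.card = k}, ineq c S₀.1 y₀ = 1
  · obtain ⟨S₀, hS₀⟩ := h
    have hQ := ((mem_dualPolytope c y₀).1 hy₀).2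
    rw [ineq_apply] at hS₀
    obtain ⟨p, hp⟩ := exists_supports_of_max hk hkn y₀ S₀.2 (fun S hS => by
      have := hQ ⟨S, hS⟩
      rw [ineq_apply] at this
      linarith)
    refine ⟨p, fun S => ?_⟩
    rw [← hp S.1 S.2, ineq_apply, ← hS₀, sub_left_inj]
  · exact ⟨⟨(Finset.univ, Finset.univ), Or.inr (Or.inr rfl)⟩, fun S =>
      iff_of_false (fun hS => h ⟨S, hS⟩) (not_supports_univ (by omega) S.1)⟩

/-- The face lattice of the dual hypersimplex. -/
noncomputable def faceLatticeIso (hk : 0 < k) (hkn : k < n)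
    (hc : c ∈ intrinsicInterior ℝ (hypersimplex k n)) :
    CoFace k n ≃o FaceLattice (dualPolytope (hypersimplex k n) c) :=
  RelIso.ofSurjective
    (OrderEmbedding.ofMapLEIff
      (fun p => (⟨dualFace c p, isExposed_dualFace p⟩ :
        FaceLattice (dualPolytope (hypersimplex k n) c)))
      (dualFace_subset_iff hk hkn hc))
    (fun B => by
      obtain ⟨p, hp⟩ := exists_eq_dualFace hk hkn (intrinsicInterior_subset hc) B.2
      exact ⟨p, Subtype.ext hp⟩)

lemma toricH_dual (hk : 0 < k) (hkn : 2 * k ≤ n)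
    (hc : c ∈ intrinsicInterior ℝ (hypersimplex k n)) (r : ℕ) :
    toricH (dualPolytope (hypersimplex k n) c) r =
      ∑ i ∈ Finset.range k, if i ≤ r ∧ r < n - i then (n.choose i : ℤ) else 0 := by
  let e := faceLatticeIso hk (by omega) hc
  have hfin : Finite (FaceLattice (dualPolytope (hypersimplex k n) c)) :=
    Finite.of_equiv _ e.toEquiv
  have htop : e ⟨(Finset.univ, Finset.univ), Or.inr (Or.inr rfl)⟩ = ⊤ := by
    obtain ⟨p, hp⟩ := e.surjective ⊤
    refine top_unique ?_
    rw [← hp, e.le_iff_le]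
    exact ⟨Finset.subset_univ _, Finset.subset_univ _⟩
  rw [toricH, dif_pos hfin, toricHPoly, ← htop, toricHBelow_top hk hkn e, coeff_model]

end Iso

end HypersimplexDual

/-! ### Reading off the coefficients -/

theorem theorem2 (n k : ℕ) (hk : 1 ≤ k) (hkn : k ≤ n / 2)
    (c : EuclideanSpace ℝ (Fin n)) (hc : c ∈ intrinsicInterior ℝ (hypersimplex k n)) :
    (∀ r : ℕ, r ≤ k - 1 →
      toricH (dualPolytope (hypersimplex k n) c) r
        = ∑ i ∈ Finset.range (r + 1), (n.choose i : ℤ)) ∧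
    (∀ r : ℕ, k ≤ r → r ≤ n / 2 →
      toricH (dualPolytope (hypersimplex k n) c) r
        = ∑ i ∈ Finset.range k, (n.choose i : ℤ)) ∧
    (∀ r : ℕ, r ≤ n - 1 →
      toricH (dualPolytope (hypersimplex k n) c) r
        = toricH (dualPolytope (hypersimplex k n) c) (n - 1 - r)) := by
  simp only [HypersimplexDual.toricH_dual hk (by omega : 2 * k ≤ n) hc]
  refine ⟨fun r hr => ?_, fun r hr hr' => ?_, fun r hr => ?_⟩
  · rw [← Finset.sum_filter]
    congr 1
    ext i
    simp only [Finset.mem_filter, Finset.mem_range]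
    omega
  · refine Finset.sum_congr rfl fun i hi => if_pos ?_
    rw [Finset.mem_range] at hi
    omega
  -- Each block `x^i + ⋯ + x^(n-i-1)` is invariant under `r ↦ n - 1 - r`.
  · refine Finset.sum_congr rfl fun i hi => ?_
    rw [Finset.mem_range] at hi
    have : (i ≤ r ∧ r < n - i) ↔ (i ≤ n - 1 - r ∧ n - 1 - r < n - i) := by omega
    simp only [this]
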